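/- Let $L,r\ge 1$ be integers and $\rho=Lr$. Let $\mathcal A_r$ be the class of $(r-1)$-times continuously differentiable $\varphi:\mathbb R\to\mathbb C$ such that, for some $\epsilon,C>0$, $|\varphi^{(p)}(t)|\le C(1+|t|)^{-1-\epsilon}$ and $|\widehat{\varphi^{(p)}}(w)|\le C(1+|w|)^{-1-\epsilon}$ for all $t,w\in\mathbb R$ and $0\le p\le r-1$, where $\widehat g(w)=\int_{\mathbb R} g(t)e^{-2\pi \mathrm i wt}\,dt$. For $\varphi\in L^2(\mathbb R)$ let $V(\varphi)=\{\sum_{k\in\mathbb Z}d_k\varphi(\cdot-k):(d_k)\in\ell^2(\mathbb Z)\}$ (convergence in $L^2(\mathbb R)$); $\varphi$ is a stable generator for $V(\varphi)$ if $\{\varphi(\cdot-k)\}_{k\in\mathbb Z}$ is a Riesz basis of $V(\varphi)$, that is, its closed linear span is $V(\varphi)$ and there are $A,B>0$ with $A\sum_k|d_k|^2\le\|\sum_k d_k\varphi(\cdot-k)\|_2^2\le B\sum_k|d_k|^2$ for all $(d_k)\in\ell^2(\mathbb Z)$. Elements of $V(\varphi)$ are identified with their continuous representatives. A set $\Gamma\subset\mathbb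 R$ is a complete interpolation set of order $r-1$ for $V(\varphi)$ if (i) there are $A,B>0$ with $A\|f\|_2^2\le\sum_{x\in\Gamma}\sum_{i=0}^{r-1}|f^{(i)}(x)|^2\le B\|f\|_2^2$ for all $f\in V(\varphi)$, and (ii) for every square summable family $(c_{xi})_{x\in\Gamma,\,0\le i\le r-1}$ of complex numbers there is $f\in V(\varphi)$ with $f^{(i)}(x)=c_{xi}$ for all $x\in\Gamma$, $0\le i\le r-1$. **Theorem.** Let $\varphi\in\mathcal A_r$ be a stable generator for $V(\varphi)$ with support contained in $[0,\mu]$, where $\mu\in\mathbb R$ and $\rho=Lr\ge\mu$. Let $s\in\{0,1,\dots,\rho-1\}$, $x_0,\dots,x_{L-1}\in[s,s+1)$ and $X=\{x_n+\rho l:0\le n\le L-1,\ l\in\mathbb Z\}$. For $0\le i,j\le\rho-1$ put $d_i=i\bmod r$, $t_i=x_{\lfloor i/r\rfloor}$ and $\varphi_j(y)=\varphi(y-(s+1-\rho+j))$. Then $X$ is a complete interpolation set of order $r-1$ for $V(\varphi)$ if and only if $$\det\big[\varphi_j^{(d_i)}(t_i)\big]_{i,j=0}^{\rho-1}\ne 0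 .$$ Assume that this is the case. Let $\Psi(u)=\big[\sum_{k\in\mathbb Z}\varphi^{(d_i)}(t_i+\rho k-q)\,e^{2\pi \mathrm i ku}\big]_{i,q=0}^{\rho-1}$, let $\widehat{\Psi^{-1}}(\nu)=\int_0^1 e^{-2\pi \mathrm i\nu u}\,\Psi(u)^{-1}\,du$ for $\nu\in\mathbb Z$, and for $0\le n\le L-1$, $0\le i\le r-1$ let $$\Theta_{ni}(t)=\sum_{\nu=-1}^{0}\sum_{q=0}^{\rho-1}\big[\widehat{\Psi^{-1}}(\nu)\big]_{q,\,nr+i}\,\varphi(t-\rho\nu-q).$$ Then $$\Theta_{ni}(t)=\sum_{q=0}^{s}\big[\widehat{\Psi^{-1}}(0)\big]_{q,\,nr+i}\,\varphi(t-q)+\sum_{q=s+1}^{\rho-1}\big[\widehat{\Psi^{-1}}(-1)\big]_{q,\,nr+i}\,\varphi(t+\rho-q),$$ each $\Theta_{ni}$ belongs to $\mathcal A_r$ and has support contained in $[-\rho+s+1,\mu+s]$, and every $f\in V(\varphi)$ is $(r-1)$-times continuously differentiable and satisfies, for every $t\in\mathbb R$ (all the series being convergent), $$f(t)=\sum_{n=0}^{L-1}\sum_{l\in\mathbb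 Z}\sum_{i=0}^{r-1}f^{(i)}(x_n+\rho l)\,\Theta_{ni}(t-\rho l).$$ -/

import Mathlib

open MeasureTheory
open scoped ENNReal FourierTransform

namespace PNS

noncomputable section

/-- The class `A_r` of `(r-1)`-times continuously differentiable functions all of whose derivatives
of order at most `r-1` decay, together with their Fourier transforms, like `(1+|·|)^(-1-ε)`. -/
def ClassA (r : ℕ) (φ : ℝ → ℂ) : Prop :=
  ContDiff ℝ ((r - 1 : ℕ) : WithTop ℕ∞) φ ∧
    ∃ ε > (0 : ℝ), ∃ C > (0 : ℝ), ∀ p < r,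
      (∀ t : ℝ, ‖iteratedDeriv p φ t‖ ≤ C * (1 + |t|) ^ (-1 - ε)) ∧
      (∀ w : ℝ, ‖𝓕 (iteratedDeriv p φ) w‖ ≤ C * (1 + |w|) ^ (-1 - ε))

/-- The class in `L²(ℝ)` of the integer translate `φ(· - k)`. -/
def shiftL2 (φ : ℝ → ℂ) (hφ : MemLp φ 2 (volume : Measure ℝ)) (k : ℤ) :
    Lp ℂ 2 (volume : Measure ℝ) :=
  (hφ.comp_measurePreserving (measurePreserving_sub_right volume (k : ℝ))).toLp
    (φ ∘ fun t : ℝ => t - (k : ℝ))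

/-- The shift-invariant space `V(φ)` inside `L²(ℝ)`: all sums `∑ₖ dₖ φ(· - k)`, convergent in
`L²(ℝ)`, with `(dₖ) ∈ ℓ²(ℤ)`. -/
def shiftSpaceL2 (φ : ℝ → ℂ) (hφ : MemLp φ 2 (volume : Measure ℝ)) :
    Set (Lp ℂ 2 (volume : Measure ℝ)) :=
  {f | ∃ d : lp (fun _ : ℤ => ℂ) 2, HasSum (fun k : ℤ => d k • shiftL2 φ hφ k) f}

/-- `φ ∈ L²(ℝ)` is a stable generator for `V(φ)`: its integer translates form a Riesz basis
of `V(φ)`. -/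
def IsStableGenerator (φ : ℝ → ℂ) : Prop :=
  ∃ hφ : MemLp φ 2 (volume : Measure ℝ),
    ((Submodule.span ℂ (Set.range (shiftL2 φ hφ))).topologicalClosure :
        Set (Lp ℂ 2 (volume : Measure ℝ))) = shiftSpaceL2 φ hφ ∧
    ∃ A > (0 : ℝ), ∃ B > (0 : ℝ), ∀ d : lp (fun _ : ℤ => ℂ) 2,
      Summable (fun k : ℤ => d k • shiftL2 φ hφ k) ∧
      A * ∑' k : ℤ, ‖d k‖ ^ 2 ≤ ‖∑' k : ℤ, d k • shiftL2 φ hφ k‖ ^ 2 ∧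
      ‖∑' k : ℤ, d k • shiftL2 φ hφ k‖ ^ 2 ≤ B * ∑' k : ℤ, ‖d k‖ ^ 2

/-- `V(φ)` as a set of functions: an element of `V(φ) ⊆ L²(ℝ)` is evaluated through its
(unique) continuous representative. -/
def shiftSpace (φ : ℝ → ℂ) : Set (ℝ → ℂ) :=
  {f | Continuous f ∧ ∃ (hφ : MemLp φ 2 (volume : Measure ℝ))
    (hf : MemLp f 2 (volume : Measure ℝ)), hf.toLp f ∈ shiftSpaceL2 φ hφ}

/-- `Γ` is a set of stable sampling of order `r - 1` for `V(φ)`. -/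
def IsStableSampling (r : ℕ) (φ : ℝ → ℂ) (Γ : Set ℝ) : Prop :=
  ∃ A > (0 : ℝ), ∃ B > (0 : ℝ), ∀ f ∈ shiftSpace φ,
    Summable (fun p : Γ × Fin r => ‖iteratedDeriv (p.2 : ℕ) f (p.1 : ℝ)‖ ^ 2) ∧
    A * ∫ t : ℝ, ‖f t‖ ^ 2 ≤ ∑' p : Γ × Fin r, ‖iteratedDeriv (p.2 : ℕ) f (p.1 : ℝ)‖ ^ 2 ∧
    ∑' p : Γ × Fin r, ‖iteratedDeriv (p.2 : ℕ) f (p.1 : ℝ)‖ ^ 2 ≤ B * ∫ t : ℝ, ‖f t‖ ^ 2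

/-- `Γ` is a set of interpolation of order `r - 1` for `V(φ)`. -/
def IsInterpolation (r : ℕ) (φ : ℝ → ℂ) (Γ : Set ℝ) : Prop :=
  ∀ c : Γ × Fin r → ℂ, Summable (fun p => ‖c p‖ ^ 2) →
    ∃ f ∈ shiftSpace φ, ∀ p : Γ × Fin r, iteratedDeriv (p.2 : ℕ) f (p.1 : ℝ) = c p

/-- `Γ` is a complete interpolation set of order `r - 1` for `V(φ)`. -/
def IsCompleteInterpolation (r : ℕ) (φ : ℝ → ℂ) (Γ : Set ℝ) : Prop :=
  IsStableSampling r φ Γ ∧ IsInterpolation r φ Γ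

/-- The periodic nonuniform sampling set `{xₙ + ρ l : 0 ≤ n < L, l ∈ ℤ}`. -/
def samplingSet {L : ℕ} (ρ : ℕ) (x : Fin L → ℝ) : Set ℝ :=
  {y | ∃ (n : Fin L) (l : ℤ), y = x n + (ρ : ℝ) * (l : ℝ)}

/-- The matrix `[φ_j^{(d_i)}(t_i)]`, `0 ≤ i, j < ρ = L r`, where `d_i = i mod r`,
`t_i = x_{⌊i / r⌋}` and `φ_j(y) = φ(y - (s + 1 - ρ + j))`. -/
def collocation {L r : ℕ} (φ : ℝ → ℂ) (x : Fin L → ℝ) (s : ℕ) :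
    Matrix (Fin (L * r)) (Fin (L * r)) ℂ :=
  Matrix.of fun i j =>
    iteratedDeriv (i.modNat : ℕ)
      (fun y : ℝ => φ (y - ((s : ℝ) + 1 - ((L * r : ℕ) : ℝ) + ((j : ℕ) : ℝ)))) (x i.divNat)

/-- The polyphase matrix `Ψ(u)`, with entries
`∑ₖ φ^{(i mod r)}(x_{⌊i / r⌋} + ρ k - q) e^{2π i k u}`, `0 ≤ i, q < ρ = L r`. -/
def polyphase {L r : ℕ} (φ : ℝ → ℂ) (x : Fin L → ℝ) (u : ℝ) :
    Matrix (Fin (L * r)) (Fin (L * r)) ℂ :=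
  Matrix.of fun i q => ∑' k : ℤ,
    iteratedDeriv (i.modNat : ℕ) φ
        (x i.divNat + ((L * r : ℕ) : ℝ) * (k : ℝ) - ((q : ℕ) : ℝ)) *
      Complex.exp (2 * (Real.pi : ℂ) * Complex.I * (k : ℂ) * (u : ℂ))

/-- The `ν`-th Fourier coefficient of the `(q, n r + i)` entry of `Ψ⁻¹`. -/
def invCoeff {L r : ℕ} (φ : ℝ → ℂ) (x : Fin L → ℝ) (ν : ℤ) (q : Fin (L * r))
    (n : Fin L) (i : Fin r) : ℂ :=
  ∫ u in (0 : ℝ)..1,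
    Complex.exp (-(2 * (Real.pi : ℂ) * Complex.I * (ν : ℂ) * (u : ℂ))) *
      (polyphase (r := r) φ x u)⁻¹ q (finProdFinEquiv (n, i))

/-- The interpolating kernels
`Θ_{ni}(t) = ∑_{ν=-1}^{0} ∑_{q=0}^{ρ-1} (Ψ⁻¹)^(ν)_{q, n r + i} φ(t - ρ ν - q)`, `ρ = L r`. -/
def kernel {L r : ℕ} (φ : ℝ → ℂ) (x : Fin L → ℝ) (n : Fin L) (i : Fin r) (t : ℝ) : ℂ :=
  ∑ ν ∈ Finset.Icc (-1 : ℤ) 0, ∑ q : Fin (L * r),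
    invCoeff φ x ν q n i * φ (t - ((L * r : ℕ) : ℝ) * (ν : ℝ) - ((q : ℕ) : ℝ))

end

end PNS

namespace PNS

noncomputable section

/-! Sampling is block diagonal. Write ρ = Lr. The continuous derivatives of φ vanish outside the
open interval (0, ρ), so at a point of [s, s+1) + ρl the only translates φ(· - k) that contribute
have k in {s+1-ρ, …, s} + ρl. These windows of ρ integers tile ℤ. Hence the ρ samples in period l
depend only on the l-th block of coefficients, through one matrix N (`sampleMatrix`) that does not
depend on l (`synth_sample`, `iteratedDeriv_synth_sample`).

The Riesz condition makes the coefficient norm in ℓ² and the norm of V(φ) equivalent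
(`exists_synth_bounds`), so complete interpolation amounts to invertibility of N on every block. If
N is invertible, N and N⁻¹ act boundedly on blocks (`exists_blockwise_bound`); if not, a kernel
vector in a single block gives a nonzero function with vanishing samples. N is the collocation
matrix with its columns permuted.

Indexing columns by residues 0, …, ρ-1 instead of the window shifts those above s by one period, so
Ψ(u) = N·diag(e^{2πi·carry·u}). Thus Ψ⁻¹ has frequencies 0 and -1 only, the kernels are combinations
of window translates with coefficients from N⁻¹ (`kernel_eq`), and the reconstruction formula is
N⁻¹N = 1 on each block. -/

/-! ### Locally finite sums of integer translates -/

/-- The locally finite sum `∑ₖ dₖ g(t - k)`. -/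
def synth (g : ℝ → ℂ) (d : ℤ → ℂ) (t : ℝ) : ℂ := ∑' k : ℤ, d k * g (t - k)

/-- The support of a continuous function is open, so it lies in the interior of the closed interval.
Losing the endpoints is what limits a node at `s` to ρ active translates. -/
lemma support_iteratedDeriv_subset_Ioo {φ : ℝ → ℂ} {r : ℕ} {b : ℝ}
    (hφ : ContDiff ℝ ((r - 1 : ℕ) : WithTop ℕ∞) φ) (hsupp : tsupport φ ⊆ Set.Icc 0 b)
    {p : ℕ} (hp : p < r) : Function.support (iteratedDeriv p φ) ⊆ Set.Ioo 0 b := by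
  have hc : Continuous (iteratedDeriv p φ) :=
    hφ.continuous_iteratedDeriv p (by exact_mod_cast Nat.le_sub_one_of_lt hp)
  have ho : IsOpen (Function.support (iteratedDeriv p φ)) := hc.isOpen_support
  rw [← interior_Icc]
  refine ho.subset_interior_iff.2 fun t ht => hsupp ?_
  refine support_iteratedFDeriv_subset (𝕜 := ℝ) p ?_
  intro h0
  apply ht
  rw [iteratedDeriv_eq_iteratedFDeriv, h0]
  rfl

lemma translate_eq_zero {g : ℝ → ℂ} {b : ℕ} (hg : Function.support g ⊆ Set.Icc 0 (b : ℝ))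
    {T : ℕ} {t : ℝ} (ht : |t| < T) {k : ℤ}
    (hk : k ∉ Finset.Icc (-((T : ℤ) + b)) ((T : ℤ) + b)) : g (t - k) = 0 := by
  by_contra h
  obtain ⟨h1, h2⟩ := hg h
  obtain ⟨h3, h4⟩ := abs_lt.1 ht
  apply hk
  rw [Finset.mem_Icc]
  have hb : (0 : ℝ) ≤ b := Nat.cast_nonneg b
  constructor
  · have : (-((T : ℝ) + b)) ≤ k := by linarith
    exact_mod_cast this
  · have : (k : ℝ) ≤ (T : ℝ) + b := by linarith
    exact_mod_cast this

lemma finite_support_translates {g : ℝ → ℂ} {b : ℕ} (hg : Function.support g ⊆ Set.Icc 0 (b : ℝ))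
    (d : ℤ → ℂ) (t : ℝ) : (Function.support fun k : ℤ => d k * g (t - k)).Finite := by
  obtain ⟨T, hT⟩ := exists_nat_gt |t|
  refine (Finset.finite_toSet (Finset.Icc (-((T : ℤ) + b)) ((T : ℤ) + b))).subset fun k hk => ?_
  by_contra h
  exact hk (by simp only [translate_eq_zero hg hT h, mul_zero])

lemma hasSum_synth {g : ℝ → ℂ} {b : ℕ} (hg : Function.support g ⊆ Set.Icc 0 (b : ℝ))
    (d : ℤ → ℂ) (t : ℝ) : HasSum (fun k : ℤ => d k * g (t - k)) (synth g d t) :=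
  (summable_of_hasFiniteSupport (finite_support_translates hg d t)).hasSum

/-- One finite index set serves a whole neighbourhood, so smoothness and derivatives may be computed
term by term. -/
lemma synth_eventuallyEq {g : ℝ → ℂ} {b : ℕ} (hg : Function.support g ⊆ Set.Icc 0 (b : ℝ))
    (d : ℤ → ℂ) {T : ℕ} {t : ℝ} (ht : |t| < T) : synth g d =ᶠ[nhds t]
      fun y => ∑ k ∈ Finset.Icc (-((T : ℤ) + b)) ((T : ℤ) + b), d k * g (y - k) := by
  have : ∀ᶠ y : ℝ in nhds t, |y| < T := continuous_abs.continuousAt.eventually_lt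
    continuousAt_const ht
  filter_upwards [this] with y hy
  exact tsum_eq_sum fun k hk => by rw [translate_eq_zero hg hy hk, mul_zero]

lemma contDiff_translate {g : ℝ → ℂ} {n : WithTop ℕ∞} (hg : ContDiff ℝ n g) (c : ℂ) (a : ℝ) :
    ContDiff ℝ n fun y => c * g (y - a) :=
  contDiff_const.mul (hg.comp (contDiff_id.sub contDiff_const))

lemma iteratedDeriv_translate (g : ℝ → ℂ) (c : ℂ) (a : ℝ) (p : ℕ) :
    iteratedDeriv p (fun y => c * g (y - a)) = fun y => c * iteratedDeriv p g (y - a) := by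
  ext y
  rw [iteratedDeriv_const_mul_field, iteratedDeriv_comp_sub_const]

lemma contDiff_synth {g : ℝ → ℂ} {b : ℕ} {n : WithTop ℕ∞} (hg : ContDiff ℝ n g)
    (hs : Function.support g ⊆ Set.Icc 0 (b : ℝ)) (d : ℤ → ℂ) : ContDiff ℝ n (synth g d) := by
  rw [contDiff_iff_contDiffAt]
  intro t
  obtain ⟨T, hT⟩ := exists_nat_gt |t|
  exact (ContDiff.sum fun k _ => contDiff_translate hg (d k) k).contDiffAt.congr_of_eventuallyEq
    (synth_eventuallyEq hs d hT)

lemma iteratedDeriv_synth {φ : ℝ → ℂ} {r b : ℕ}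
    (hφ : ContDiff ℝ ((r - 1 : ℕ) : WithTop ℕ∞) φ) (hsupp : tsupport φ ⊆ Set.Icc 0 (b : ℝ))
    {p : ℕ} (hp : p < r) (d : ℤ → ℂ) :
    iteratedDeriv p (synth φ d) = synth (iteratedDeriv p φ) d := by
  ext t
  have hs : Function.support φ ⊆ Set.Icc 0 (b : ℝ) := (subset_tsupport φ).trans hsupp
  have hs' : Function.support (iteratedDeriv p φ) ⊆ Set.Icc 0 (b : ℝ) :=
    (support_iteratedDeriv_subset_Ioo hφ hsupp hp).trans Set.Ioo_subset_Icc_self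
  have hp' : ((p : ℕ) : WithTop ℕ∞) ≤ ((r - 1 : ℕ) : WithTop ℕ∞) := by
    exact_mod_cast Nat.le_sub_one_of_lt hp
  obtain ⟨T, hT⟩ := exists_nat_gt |t|
  rw [(synth_eventuallyEq hs d hT).iteratedDeriv_eq, iteratedDeriv_fun_sum fun k _ =>
    ((contDiff_translate hφ (d k) k).of_le hp').contDiffAt]
  simp_rw [iteratedDeriv_translate]
  exact (synth_eventuallyEq hs' d hT).self_of_nhds.symm

/-! ### Pointwise description of `V(φ)` -/

lemma shiftL2_coeFn (φ : ℝ → ℂ) (hφ : MemLp φ 2 (volume : Measure ℝ)) (k : ℤ) :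
    shiftL2 φ hφ k =ᵐ[volume] fun t => φ (t - k) := MemLp.coeFn_toLp _

/-- Convergence in L² gives almost everywhere convergence along a subsequence of the partial sums
over [-n, n], while pointwise these sums tend to the locally finite sum. -/
lemma coeFn_eq_synth {φ : ℝ → ℂ} {b : ℕ} (hs : Function.support φ ⊆ Set.Icc 0 (b : ℝ))
    (hφ : MemLp φ 2 (volume : Measure ℝ)) {d : ℤ → ℂ} {F : Lp ℂ 2 (volume : Measure ℝ)}
    (h : HasSum (fun k : ℤ => d k • shiftL2 φ hφ k) F) : F =ᵐ[volume] synth φ d := by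
  have ht : Filter.Tendsto (fun n : ℕ => Finset.Icc (-(n : ℤ)) n) Filter.atTop Filter.atTop :=
    Finset.tendsto_Icc_neg.comp tendsto_natCast_atTop_atTop
  obtain ⟨ns, hns, hae⟩ := (tendstoInMeasure_of_tendsto_Lp
    (Filter.Tendsto.comp h ht)).exists_seq_tendsto_ae
  -- There are countably many finite sets of integers, so one null set handles all partial sums.
  have hfin : ∀ᵐ t : ℝ, ∀ s : Finset ℤ,
      (↑(∑ k ∈ s, d k • shiftL2 φ hφ k : Lp ℂ 2 (volume : Measure ℝ)) : ℝ → ℂ) t =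
        ∑ k ∈ s, d k * φ (t - k) := by
    rw [ae_all_iff]
    intro s
    have h1 : ∀ᵐ t : ℝ, ∀ k : ℤ, (d k • shiftL2 φ hφ k : Lp ℂ 2 (volume : Measure ℝ)) t =
        d k * φ (t - k) := by
      rw [ae_all_iff]
      intro k
      filter_upwards [Lp.coeFn_smul (d k) (shiftL2 φ hφ k), shiftL2_coeFn φ hφ k] with t h1 h2
      rw [h1, Pi.smul_apply, h2, smul_eq_mul]
    filter_upwards [Lp.coeFn_finsetSum s fun k => d k • shiftL2 φ hφ k, h1] with t h2 h3
    rw [h2, Finset.sum_apply]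
    exact Finset.sum_congr rfl fun k _ => h3 k
  filter_upwards [hae, hfin] with t h1 h2
  refine tendsto_nhds_unique h1 ?_
  have h3 := ((hasSum_synth hs d t).comp ht).comp hns.tendsto_atTop
  refine h3.congr fun n => ?_
  exact (h2 (Finset.Icc (-(ns n : ℤ)) (ns n))).symm

lemma eq_synth_of_mem {φ : ℝ → ℂ} {b : ℕ} (hc : Continuous φ)
    (hs : Function.support φ ⊆ Set.Icc 0 (b : ℝ)) {f : ℝ → ℂ} (hf : f ∈ shiftSpace φ) :
    ∃ d : ℤ → ℂ, Summable (fun k => ‖d k‖ ^ 2) ∧ f = synth φ d := by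
  obtain ⟨hfc, hφ, hfm, d, hd⟩ := hf
  refine ⟨d, ?_, (Continuous.ae_eq_iff_eq volume hfc ?_).1 ?_⟩
  · have := (memℓp_gen_iff (by norm_num)).1 (lp.memℓp d)
    simpa using this
  · exact (contDiff_synth (n := 0) (contDiff_zero.2 hc) hs d).continuous
  · exact hfm.coeFn_toLp.symm.trans (coeFn_eq_synth hs hφ hd)

lemma norm_toLp_sq {f : ℝ → ℂ} (hf : MemLp f 2 (volume : Measure ℝ)) :
    ‖hf.toLp f‖ ^ 2 = ∫ t, ‖f t‖ ^ 2 := by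
  have h : (inner ℂ (hf.toLp f) (hf.toLp f)).re = ‖hf.toLp f‖ ^ 2 := by
    have := inner_self_eq_norm_sq (𝕜 := ℂ) (hf.toLp f)
    exact this
  rw [← h, L2.inner_def]
  have : ∫ a, inner ℂ ((hf.toLp f : Lp ℂ 2 (volume : Measure ℝ)) a)
      ((hf.toLp f : Lp ℂ 2 (volume : Measure ℝ)) a)
      = ∫ a, ((‖f a‖ ^ 2 : ℝ) : ℂ) := by
    refine integral_congr_ae ?_
    filter_upwards [hf.coeFn_toLp] with t ht
    rw [ht, inner_self_eq_norm_sq_to_K]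
    simp
  rw [this, integral_complex_ofReal, Complex.ofReal_re]

/-- Under stability, every square summable sequence synthesizes an element of `V(φ)`, and its
`L²` norm is comparable with the `ℓ²` norm of the coefficients. -/
lemma exists_synth_bounds {φ : ℝ → ℂ} {b : ℕ} (hc : Continuous φ)
    (hs : Function.support φ ⊆ Set.Icc 0 (b : ℝ)) (hst : IsStableGenerator φ) :
    ∃ A > (0 : ℝ), ∃ B > (0 : ℝ), ∀ d : ℤ → ℂ, Summable (fun k => ‖d k‖ ^ 2) →
      synth φ d ∈ shiftSpace φ ∧ A * ∑' k, ‖d k‖ ^ 2 ≤ ∫ t, ‖synth φ d t‖ ^ 2 ∧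
        ∫ t, ‖synth φ d t‖ ^ 2 ≤ B * ∑' k, ‖d k‖ ^ 2 := by
  obtain ⟨hφ, -, A, hA, B, hB, H⟩ := hst
  refine ⟨A, hA, B, hB, fun d hd => ?_⟩
  have hmem : Memℓp d 2 := by
    refine (memℓp_gen_iff (by norm_num)).2 ?_
    simpa using hd
  obtain ⟨h1, h2, h3⟩ := H ⟨d, hmem⟩
  have hae := coeFn_eq_synth hs hφ (d := d) h1.hasSum
  have hm : MemLp (synth φ d) 2 (volume : Measure ℝ) := (memLp_congr_ae hae).1 (Lp.memLp _)
  have heq : hm.toLp (synth φ d) = ∑' k : ℤ, d k • shiftL2 φ hφ k := by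
    refine Lp.ext ?_
    exact hm.coeFn_toLp.trans hae.symm
  rw [← norm_toLp_sq hm, heq]
  refine ⟨⟨(contDiff_synth (n := 0) (contDiff_zero.2 hc) hs d).continuous, hφ, hm, ⟨d, hmem⟩, ?_⟩,
    h2, h3⟩
  rw [heq]
  exact h1.hasSum

/-! ### Residue blocks -/

/-- The carry `0` or `1` that moves the residue `q` into the window `{s + 1 - ρ, …, s}`. -/
def carry (s q : ℕ) : ℤ := if q ≤ s then 0 else 1

/-- The representative of `q` modulo `ρ` in the window `{s + 1 - ρ, …, s}`. -/
def windowRep (ρ s q : ℕ) : ℤ := q - ρ * carry s q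

lemma windowRep_bounds {ρ s q : ℕ} (hs : s < ρ) (hq : q < ρ) :
    (s : ℤ) + 1 - ρ ≤ windowRep ρ s q ∧ windowRep ρ s q ≤ s := by
  unfold windowRep carry
  split_ifs <;> constructor <;> omega

/-- The window consists of ρ consecutive integers, hence is a complete residue system modulo ρ. -/
lemma windowRep_block_bijective {ρ s : ℕ} (hs : s < ρ) :
    Function.Bijective fun p : Fin ρ × ℤ => windowRep ρ s p.1 + (ρ : ℤ) * p.2 := by
  have hρ : (0 : ℤ) < ρ := by omega
  constructor
  · rintro ⟨q, l⟩ ⟨q', l'⟩ h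
    simp only [windowRep] at h
    have hdvd : (ρ : ℤ) ∣ (q : ℤ) - q' :=
      ⟨carry s q - carry s q' + l' - l, by linear_combination h⟩
    have h0 : (q : ℤ) - q' = 0 := by
      refine Int.eq_zero_of_abs_lt_dvd hdvd ?_
      rw [abs_lt]
      have := q.2
      have := q'.2
      omega
    have hq : q = q' := by ext; omega
    subst hq
    have : (ρ : ℤ) * l = ρ * l' := by linarith
    rw [mul_left_cancel₀ hρ.ne' this]
  · intro k
    have h1 := Int.emod_nonneg k hρ.ne'
    have h2 := Int.emod_lt_of_pos k hρ
    refine ⟨(⟨(k % ρ).toNat, by omega⟩, k / ρ + carry s (k % ρ).toNat), ?_⟩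
    simp only [windowRep]
    rw [Int.toNat_of_nonneg h1]
    linear_combination Int.emod_add_mul_ediv k ρ

/-- Integers split into a residue in the window and a block number. -/
def blockEquiv {ρ s : ℕ} (hs : s < ρ) : Fin ρ × ℤ ≃ ℤ :=
  Equiv.ofBijective _ (windowRep_block_bijective hs)

@[simp] lemma blockEquiv_apply {ρ s : ℕ} (hs : s < ρ) (q : Fin ρ) (l : ℤ) :
    blockEquiv hs (q, l) = windowRep ρ s q + (ρ : ℤ) * l := rfl

/-- Only one block meets the support of a function living on `(0, ρ)`. -/
lemma eq_zero_of_block_ne {g : ℝ → ℂ} {ρ s : ℕ} (hg : Function.support g ⊆ Set.Ioo 0 (ρ : ℝ))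
    {t : ℝ} (ht : t ∈ Set.Ico (s : ℝ) (s + 1)) (hs : s < ρ) (q : Fin ρ) {m : ℤ} (hm : m ≠ 0) :
    g (t - windowRep ρ s q + ρ * m) = 0 := by
  by_contra h
  obtain ⟨h1, h2⟩ := hg h
  obtain ⟨h3, h4⟩ := windowRep_bounds hs q.2
  have h3' : (s : ℝ) + 1 - ρ ≤ windowRep ρ s q := by exact_mod_cast h3
  have h4' : (windowRep ρ s q : ℝ) ≤ s := by exact_mod_cast h4
  obtain ⟨h5, h6⟩ := ht
  have hρ : (0 : ℝ) < ρ := by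
    have : 0 < ρ := by omega
    exact_mod_cast this
  rcases lt_or_gt_of_ne hm with hm | hm
  · have : (m : ℝ) ≤ -1 := by exact_mod_cast (by omega : m ≤ -1)
    nlinarith
  -- The argument is now at least ρ, with equality possible at `t = s`; this case needs the open
  -- interval.
  · have : (1 : ℝ) ≤ m := by exact_mod_cast hm
    nlinarith

lemma synth_sample {g : ℝ → ℂ} {ρ s : ℕ} (hg : Function.support g ⊆ Set.Ioo 0 (ρ : ℝ))
    {t : ℝ} (ht : t ∈ Set.Ico (s : ℝ) (s + 1)) (hs : s < ρ) (d : ℤ → ℂ) (l : ℤ) :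
    synth g d (t + ρ * l) =
      ∑ q : Fin ρ, g (t - windowRep ρ s q) * d (blockEquiv hs (q, l)) := by
  unfold synth
  rw [← (blockEquiv hs).tsum_eq, tsum_eq_sum (s := Finset.univ ×ˢ {l})]
  · rw [Finset.sum_product]
    refine Finset.sum_congr rfl fun q _ => ?_
    rw [Finset.sum_singleton, mul_comm]
    congr 2
    rw [blockEquiv_apply]
    push_cast
    ring
  · rintro ⟨q, m⟩ hm
    have hne : l - m ≠ 0 := by
      rintro h
      apply hm
      simp [sub_eq_zero.1 h]
    have := eq_zero_of_block_ne hg ht hs q hne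
    rw [show t + (ρ : ℝ) * l - (blockEquiv hs (q, m) : ℤ) =
      t - windowRep ρ s q + ρ * ((l - m : ℤ) : ℝ) by rw [blockEquiv_apply]; push_cast; ring, this,
      mul_zero]

lemma synth_eq_tsum_blocks {g : ℝ → ℂ} {ρ s : ℕ} (hg : Function.support g ⊆ Set.Icc 0 (ρ : ℝ))
    (hs : s < ρ) (d : ℤ → ℂ) (t : ℝ) :
    HasSum (fun l : ℤ => ∑ q : Fin ρ,
      d (blockEquiv hs (q, l)) * g (t - ρ * l - windowRep ρ s q)) (synth g d t) := by
  have h := (((Equiv.prodComm _ _).trans (blockEquiv hs)).hasSum_iff.2 (hasSum_synth hg d t))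
  refine h.prod_fiberwise fun l => ?_
  convert hasSum_fintype (fun q : Fin ρ =>
      d (blockEquiv hs (q, l)) * g (t - ρ * l - windowRep ρ s q)) using 1
  ext q
  simp only [Function.comp_apply, Equiv.trans_apply, Equiv.prodComm_apply, Prod.swap_prod_mk,
    blockEquiv_apply]
  push_cast
  congr 2
  ring

/-! ### Matrices acting blockwise on square summable families -/

/-- Cauchy–Schwarz in each block, with the squared Frobenius norm as constant. Applied to the
sampling matrix and to its inverse, it yields the upper and lower sampling bounds. -/
lemma exists_blockwise_bound {ι κ : Type*} [Fintype ι] [Fintype κ] (N : Matrix ι κ ℂ) :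
    ∃ C > (0 : ℝ), ∀ D : κ × ℤ → ℂ, Summable (fun p => ‖D p‖ ^ 2) →
      Summable (fun p : ι × ℤ => ‖∑ q, N p.1 q * D (q, p.2)‖ ^ 2) ∧
      ∑' p : ι × ℤ, ‖∑ q, N p.1 q * D (q, p.2)‖ ^ 2 ≤ C * ∑' p, ‖D p‖ ^ 2 := by
  -- The summand 1 keeps the constant positive when `N = 0`.
  refine ⟨1 + ∑ i, ∑ q, ‖N i q‖ ^ 2, by positivity, fun D hD => ?_⟩
  have hq : ∀ q, Summable fun l : ℤ => ‖D (q, l)‖ ^ 2 := fun q =>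
    hD.comp_injective (Prod.mk_right_injective q)
  have hE : Summable fun l : ℤ => ∑ q, ‖D (q, l)‖ ^ 2 := summable_sum fun q _ => hq q
  have hEt : ∑' l : ℤ, ∑ q, ‖D (q, l)‖ ^ 2 = ∑' p, ‖D p‖ ^ 2 := by
    rw [Summable.tsum_finsetSum fun q _ => hq q, hD.tsum_prod, tsum_fintype]
  have hb : ∀ i (l : ℤ), ‖∑ q, N i q * D (q, l)‖ ^ 2 ≤
      (∑ q, ‖N i q‖ ^ 2) * ∑ q, ‖D (q, l)‖ ^ 2 := fun i l => by
    refine le_trans ?_ (Finset.sum_mul_sq_le_sq_mul_sq _ _ _)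
    gcongr
    exact (norm_sum_le _ _).trans_eq (by simp)
  have hi : ∀ i, Summable fun l : ℤ => ‖∑ q, N i q * D (q, l)‖ ^ 2 := fun i =>
    Summable.of_nonneg_of_le (fun _ => by positivity) (hb i) (hE.mul_left _)
  have hS : Summable (fun p : ι × ℤ => ‖∑ q, N p.1 q * D (q, p.2)‖ ^ 2) :=
    (summable_prod_of_nonneg fun _ => by positivity).2 ⟨hi, summable_of_hasFiniteSupport
      (Set.toFinite _)⟩
  refine ⟨hS, ?_⟩
  rw [hS.tsum_prod, tsum_fintype, ← hEt]
  calc ∑ i, ∑' l : ℤ, ‖∑ q, N i q * D (q, l)‖ ^ 2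
      ≤ ∑ i, (∑ q, ‖N i q‖ ^ 2) * ∑' l : ℤ, ∑ q, ‖D (q, l)‖ ^ 2 :=
        Finset.sum_le_sum fun i _ => by
          rw [← tsum_mul_left]
          exact (hi i).tsum_le_tsum (hb i) (hE.mul_left _)
    _ = (∑ i, ∑ q, ‖N i q‖ ^ 2) * ∑' l : ℤ, ∑ q, ‖D (q, l)‖ ^ 2 := by rw [Finset.sum_mul]
    _ ≤ _ := by
      refine mul_le_mul_of_nonneg_right (by linarith) (tsum_nonneg fun _ => by positivity)

/-! ### The sampling matrix and the polyphase matrix -/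

/-- The matrix of samples of the translates `φ(· - k)`, `k` in the window. -/
def sampleMatrix {L r : ℕ} (φ : ℝ → ℂ) (x : Fin L → ℝ) (s : ℕ) :
    Matrix (Fin (L * r)) (Fin (L * r)) ℂ :=
  Matrix.of fun i q => iteratedDeriv (i.modNat : ℕ) φ (x i.divNat - windowRep (L * r) s q)

lemma det_sampleMatrix_ne_zero_iff {L r s : ℕ} (φ : ℝ → ℂ) (x : Fin L → ℝ) (hs : s < L * r) :
    (sampleMatrix (r := r) φ x s).det ≠ 0 ↔ (collocation (r := r) φ x s).det ≠ 0 := by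
  -- Position of the representative of `q` in the increasing enumeration of the window, which orders
  -- the collocation columns.
  let τ : Fin (L * r) → Fin (L * r) := fun q =>
    ⟨(windowRep (L * r) s q - ((s : ℤ) + 1 - (L * r : ℕ))).toNat, by
      have := windowRep_bounds hs q.2
      omega⟩
  have hτ : ∀ q, ((τ q : ℕ) : ℤ) = windowRep (L * r) s q - ((s : ℤ) + 1 - (L * r : ℕ)) := fun q =>
    Int.toNat_of_nonneg (by have := windowRep_bounds hs q.2; omega)
  have hinj : Function.Injective τ := fun q q' h => by
    have h1 : windowRep (L * r) s q = windowRep (L * r) s q' := by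
      have h2 := hτ q
      rw [h, hτ q'] at h2
      linarith
    have h2 : blockEquiv hs (q, 0) = blockEquiv hs (q', 0) := by
      rw [blockEquiv_apply, blockEquiv_apply, h1]
    exact congrArg Prod.fst ((blockEquiv hs).injective h2)
  let σ : Equiv.Perm (Fin (L * r)) := Equiv.ofBijective τ (Finite.injective_iff_bijective.1 hinj)
  have hN : sampleMatrix (r := r) φ x s = (collocation (r := r) φ x s).submatrix id σ := by
    ext i q
    have h1 : ((τ q : ℕ) : ℝ) = windowRep (L * r) s q - ((s : ℝ) + 1 - (L * r : ℕ)) := by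
      exact_mod_cast hτ q
    simp only [sampleMatrix, collocation, Matrix.of_apply, Matrix.submatrix_apply, id]
    rw [iteratedDeriv_comp_sub_const]
    change _ = iteratedDeriv _ _ (_ - ((s : ℝ) + 1 - ((L * r : ℕ) : ℝ) + ((τ q : ℕ) : ℝ)))
    rw [h1]
    congr 1
    ring
  rw [hN, Matrix.det_permute']
  rcases Int.units_eq_one_or (Equiv.Perm.sign σ) with h | h <;> simp [h]

/-- In each entry only the term `k = carry s q` of the series meets the support. -/
lemma polyphase_eq {L r s : ℕ} {φ : ℝ → ℂ} {x : Fin L → ℝ} (hs : s < L * r)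
    (hφ : ∀ p < r, Function.support (iteratedDeriv p φ) ⊆ Set.Ioo 0 ((L * r : ℕ) : ℝ))
    (hx : ∀ n, x n ∈ Set.Ico (s : ℝ) ((s : ℝ) + 1)) (u : ℝ) :
    polyphase (r := r) φ x u = sampleMatrix (r := r) φ x s * Matrix.diagonal fun q : Fin (L * r) =>
      Complex.exp (2 * (Real.pi : ℂ) * Complex.I * (carry s q : ℂ) * (u : ℂ)) := by
  ext i q
  rw [Matrix.mul_diagonal]
  simp only [polyphase, sampleMatrix, Matrix.of_apply]
  have harg : ∀ k : ℤ, x i.divNat + ((L * r : ℕ) : ℝ) * (k : ℝ) - ((q : ℕ) : ℝ) =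
      x i.divNat - windowRep (L * r) s q + ((L * r : ℕ) : ℝ) * ((k - carry s q : ℤ) : ℝ) := by
    intro k
    unfold windowRep
    push_cast
    ring
  rw [tsum_eq_single (carry s q)]
  · rw [harg, sub_self, Int.cast_zero, mul_zero, add_zero]
  · intro k hk
    rw [harg, eq_zero_of_block_ne (hφ _ i.modNat.2) (hx _) hs q (sub_ne_zero.2 hk), zero_mul]

lemma integral_exp_two_pi_mul (m : ℤ) :
    ∫ u in (0 : ℝ)..1, Complex.exp (-(2 * (Real.pi : ℂ) * Complex.I * m) * u) =
      if m = 0 then 1 else 0 := by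
  split_ifs with hm
  · simp [hm]
  · rw [integral_exp_mul_complex]
    · have : Complex.exp (-(2 * (Real.pi : ℂ) * Complex.I * m)) = 1 := by
        rw [Complex.exp_eq_one_iff]
        exact ⟨-m, by push_cast; ring⟩
      simp [this]
    · simp [hm, Real.pi_ne_zero]

/-- Inverting the diagonal factor puts a single frequency, minus the carry, on row `q`;
orthogonality of the exponentials selects it. -/
lemma invCoeff_eq {L r s : ℕ} {φ : ℝ → ℂ} {x : Fin L → ℝ} (hs : s < L * r)
    (hφ : ∀ p < r, Function.support (iteratedDeriv p φ) ⊆ Set.Ioo 0 ((L * r : ℕ) : ℝ))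
    (hx : ∀ n, x n ∈ Set.Ico (s : ℝ) ((s : ℝ) + 1)) (ν : ℤ) (q : Fin (L * r))
    (n : Fin L) (i : Fin r) :
    invCoeff φ x ν q n i = if ν + carry s q = 0 then
      (sampleMatrix (r := r) φ x s)⁻¹ q (finProdFinEquiv (n, i)) else 0 := by
  have hinv : ∀ u : ℝ, (polyphase (r := r) φ x u)⁻¹ q (finProdFinEquiv (n, i)) =
      Complex.exp (-(2 * (Real.pi : ℂ) * Complex.I * (carry s q : ℂ) * (u : ℂ))) *
        (sampleMatrix (r := r) φ x s)⁻¹ q (finProdFinEquiv (n, i)) := by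
    intro u
    have hd : (Matrix.diagonal fun q : Fin (L * r) =>
        Complex.exp (2 * (Real.pi : ℂ) * Complex.I * (carry s q : ℂ) * (u : ℂ)))⁻¹ =
        Matrix.diagonal fun q : Fin (L * r) =>
          Complex.exp (-(2 * (Real.pi : ℂ) * Complex.I * (carry s q : ℂ) * (u : ℂ))) := by
      refine Matrix.inv_eq_right_inv ?_
      rw [Matrix.diagonal_mul_diagonal]
      simp only [← Complex.exp_add, add_neg_cancel, Complex.exp_zero, Matrix.diagonal_one]
    -- `Matrix.mul_inv_rev` holds for singular factors too, whose inverse is `0` by convention, so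
    -- no determinant condition enters.
    rw [polyphase_eq hs hφ hx, Matrix.mul_inv_rev, hd, Matrix.diagonal_mul]
  unfold invCoeff
  have hcong : ∀ u : ℝ, Complex.exp (-(2 * (Real.pi : ℂ) * Complex.I * (ν : ℂ) * (u : ℂ))) *
      (polyphase (r := r) φ x u)⁻¹ q (finProdFinEquiv (n, i)) =
      Complex.exp (-(2 * (Real.pi : ℂ) * Complex.I * ((ν + carry s q : ℤ) : ℂ)) * u) *
        (sampleMatrix (r := r) φ x s)⁻¹ q (finProdFinEquiv (n, i)) := by
    intro u
    rw [hinv, ← mul_assoc, ← Complex.exp_add]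
    congr 2
    push_cast
    ring
  simp_rw [hcong]
  rw [intervalIntegral.integral_mul_const, integral_exp_two_pi_mul]
  split_ifs <;> simp

lemma kernel_eq {L r s : ℕ} {φ : ℝ → ℂ} {x : Fin L → ℝ} (hs : s < L * r)
    (hφ : ∀ p < r, Function.support (iteratedDeriv p φ) ⊆ Set.Ioo 0 ((L * r : ℕ) : ℝ))
    (hx : ∀ n, x n ∈ Set.Ico (s : ℝ) ((s : ℝ) + 1)) (n : Fin L) (i : Fin r) (t : ℝ) :
    kernel φ x n i t = ∑ q, (sampleMatrix (r := r) φ x s)⁻¹ q (finProdFinEquiv (n, i)) *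
      φ (t - windowRep (L * r) s q) := by
  have hI : Finset.Icc (-1 : ℤ) 0 = {-1, 0} := rfl
  unfold kernel
  rw [hI, Finset.sum_pair (by norm_num), ← Finset.sum_add_distrib]
  refine Finset.sum_congr rfl fun q _ => ?_
  rw [invCoeff_eq hs hφ hx, invCoeff_eq hs hφ hx]
  by_cases hq : (q : ℕ) ≤ s
  · simp [windowRep, carry, hq]
  · simp only [windowRep, carry, hq, if_false, neg_add_cancel, if_true, zero_add, one_ne_zero,
      zero_mul, add_zero]
    congr 2
    push_cast
    ring

lemma kernel_eq_split {L r s : ℕ} {φ : ℝ → ℂ} {x : Fin L → ℝ} (hs : s < L * r)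
    (hφ : ∀ p < r, Function.support (iteratedDeriv p φ) ⊆ Set.Ioo 0 ((L * r : ℕ) : ℝ))
    (hx : ∀ n, x n ∈ Set.Ico (s : ℝ) ((s : ℝ) + 1)) (n : Fin L) (i : Fin r) (t : ℝ) :
    kernel φ x n i t =
      (∑ q ∈ Finset.univ.filter (fun q : Fin (L * r) => (q : ℕ) ≤ s),
        invCoeff φ x 0 q n i * φ (t - ((q : ℕ) : ℝ))) +
      ∑ q ∈ Finset.univ.filter (fun q : Fin (L * r) => s < (q : ℕ)),
        invCoeff φ x (-1) q n i * φ (t + ((L * r : ℕ) : ℝ) - ((q : ℕ) : ℝ)) := by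
  rw [kernel_eq hs hφ hx,
    ← Finset.sum_filter_add_sum_filter_not Finset.univ fun q : Fin (L * r) => (q : ℕ) ≤ s]
  simp only [not_le]
  congr 1
  · refine Finset.sum_congr rfl fun q hq => ?_
    have hq' := (Finset.mem_filter.1 hq).2
    rw [invCoeff_eq hs hφ hx]
    simp [windowRep, carry, hq']
  · refine Finset.sum_congr rfl fun q hq => ?_
    have hq' := (Finset.mem_filter.1 hq).2
    rw [invCoeff_eq hs hφ hx]
    simp only [windowRep, carry, not_le.2 hq', if_false, neg_add_cancel, if_true]
    congr 2
    push_cast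
    ring

/-! ### The class `A_r` -/

lemma norm_fourier_translate (g : ℝ → ℂ) (c : ℂ) (a w : ℝ) :
    ‖𝓕 (fun t => c * g (t - a)) w‖ = ‖c‖ * ‖𝓕 g w‖ := by
  have h : 𝓕 (fun t => c * g (t - a)) w = (Real.fourierChar (-(a * w)) : ℂ) * (c * 𝓕 g w) := by
    rw [Real.fourier_real_eq, Real.fourier_real_eq, ← integral_const_mul, ← integral_const_mul,
      ← integral_sub_right_eq_self
        (fun t => (Real.fourierChar (-(a * w)) : ℂ) * (c * Real.fourierChar (-(t * w)) • g t)) a]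
    refine integral_congr_ae (Filter.Eventually.of_forall fun t => ?_)
    have h1 : Real.fourierChar (-(t * w)) =
        Real.fourierChar (-(a * w)) * Real.fourierChar (-((t - a) * w)) := by
      rw [← AddChar.map_add_eq_mul]
      congr 1
      ring
    simp only [h1, Circle.smul_def, Circle.coe_mul, smul_eq_mul]
    ring
  rw [h, norm_mul, Circle.norm_coe, one_mul, norm_mul]

lemma fourier_sum {ι : Type*} (s : Finset ι) (F : ι → ℝ → ℂ) (hF : ∀ q ∈ s, Integrable (F q))
    (w : ℝ) : 𝓕 (fun t => ∑ q ∈ s, F q t) w = ∑ q ∈ s, 𝓕 (F q) w := by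
  simp_rw [Real.fourier_real_eq, Finset.smul_sum]
  refine integral_finsetSum s fun q hq => ?_
  have := (Real.fourierIntegral_convergent_iff (f := F q) (μ := volume) w).2 (hF q hq)
  simpa [mul_comm] using this

/-- Peetre's inequality, from 1 + |t| ≤ (1 + |a|)(1 + |t - a|). -/
lemma rpow_translate_le {ε : ℝ} (hε : 0 < ε) (t a : ℝ) :
    (1 + |t - a|) ^ (-1 - ε) ≤ (1 + |a|) ^ (1 + ε) * (1 + |t|) ^ (-1 - ε) := by
  have h1 : 0 < 1 + |t - a| := by positivity
  have h2 : 0 < 1 + |t| := by positivity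
  have h3 : 0 < 1 + |a| := by positivity
  have hle : 1 + |t| ≤ (1 + |a|) * (1 + |t - a|) := by
    have : |t| ≤ |t - a| + |a| := by simpa using abs_add_le (t - a) a
    nlinarith [mul_nonneg (abs_nonneg a) (abs_nonneg (t - a))]
  rw [show -1 - ε = -(1 + ε) by ring, Real.rpow_neg h1.le, Real.rpow_neg h2.le,
    ← div_eq_mul_inv, inv_eq_one_div, div_le_div_iff₀ (by positivity) (by positivity), one_mul,
    ← Real.mul_rpow h3.le h1.le]
  exact Real.rpow_le_rpow h2.le hle (by linarith)

/-- Finite combinations of translates of a compactly supported member of `A_r` stay in `A_r`. -/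
lemma ClassA.sum_translates {r : ℕ} {φ : ℝ → ℂ} (hA : ClassA r φ) (hK : HasCompactSupport φ)
    {ι : Type*} [Fintype ι] (c : ι → ℂ) (a : ι → ℝ) :
    ClassA r fun t => ∑ q, c q * φ (t - a q) := by
  obtain ⟨hφ, ε, hε, C, hC, H⟩ := hA
  refine ⟨ContDiff.sum fun q _ => contDiff_translate hφ (c q) (a q), ε, hε,
    -- The weight is the cost of a translation in time. In frequency a translation only changes the
    -- phase, and the weight is at least 1, so the same constant works.
    1 + ∑ q, ‖c q‖ * (C * (1 + |a q|) ^ (1 + ε)), by positivity, fun p hp => ?_⟩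
  obtain ⟨H1, H2⟩ := H p hp
  have hp' : ((p : ℕ) : WithTop ℕ∞) ≤ ((r - 1 : ℕ) : WithTop ℕ∞) := by
    exact_mod_cast Nat.le_sub_one_of_lt hp
  have hder : iteratedDeriv p (fun t => ∑ q, c q * φ (t - a q)) =
      fun t => ∑ q, c q * iteratedDeriv p φ (t - a q) := by
    ext t
    rw [iteratedDeriv_fun_sum fun q _ =>
      ((contDiff_translate hφ (c q) (a q)).of_le hp').contDiffAt]
    simp_rw [iteratedDeriv_translate]
  have hint : Integrable (iteratedDeriv p φ) := by
    refine (hφ.continuous_iteratedDeriv p hp').integrable_of_hasCompactSupport ?_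
    refine HasCompactSupport.intro hK fun t ht => ?_
    rw [iteratedDeriv_eq_iteratedFDeriv,
      Function.notMem_support.1 fun h => ht (support_iteratedFDeriv_subset (𝕜 := ℝ) p h)]
    rfl
  rw [hder]
  constructor
  · intro t
    calc ‖∑ q, c q * iteratedDeriv p φ (t - a q)‖
        ≤ ∑ q, ‖c q‖ * (C * (1 + |a q|) ^ (1 + ε)) * (1 + |t|) ^ (-1 - ε) := by
          refine norm_sum_le_of_le _ fun q _ => ?_
          rw [norm_mul, mul_assoc]
          gcongr
          refine (H1 _).trans ?_
          rw [mul_assoc]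
          gcongr
          exact rpow_translate_le hε t (a q)
      _ = (∑ q, ‖c q‖ * (C * (1 + |a q|) ^ (1 + ε))) * (1 + |t|) ^ (-1 - ε) := by
          rw [Finset.sum_mul]
      _ ≤ _ := by gcongr; linarith
  · intro w
    rw [fourier_sum _ _ fun q _ => (hint.comp_sub_right (a q)).const_mul (c q)]
    calc ‖∑ q, 𝓕 (fun t => c q * iteratedDeriv p φ (t - a q)) w‖
        ≤ ∑ q, ‖c q‖ * (C * (1 + |a q|) ^ (1 + ε)) * (1 + |w|) ^ (-1 - ε) := by
          refine norm_sum_le_of_le _ fun q _ => ?_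
          rw [norm_fourier_translate, mul_assoc]
          gcongr
          refine (H2 _).trans ?_
          gcongr
          have : (1 : ℝ) ≤ (1 + |a q|) ^ (1 + ε) :=
            Real.one_le_rpow (by linarith [abs_nonneg (a q)]) (by linarith)
          exact le_mul_of_one_le_right hC.le this
      _ = (∑ q, ‖c q‖ * (C * (1 + |a q|) ^ (1 + ε))) * (1 + |w|) ^ (-1 - ε) := by
          rw [Finset.sum_mul]
      _ ≤ _ := by gcongr; linarith

lemma tsupport_sum_translates_subset {φ : ℝ → ℂ} {μ lo hi : ℝ}
    (hsupp : tsupport φ ⊆ Set.Icc 0 μ) {ι : Type*} [Fintype ι] (c : ι → ℂ) (a : ι → ℝ)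
    (ha : ∀ q, lo ≤ a q ∧ a q ≤ hi) :
    tsupport (fun t => ∑ q, c q * φ (t - a q)) ⊆ Set.Icc lo (μ + hi) := by
  refine closure_minimal (fun t ht => ?_) isClosed_Icc
  obtain ⟨q, -, hq⟩ := Finset.exists_ne_zero_of_sum_ne_zero ht
  obtain ⟨h1, h2⟩ := hsupp (subset_tsupport φ (right_ne_zero_of_mul hq))
  obtain ⟨h3, h4⟩ := ha q
  constructor <;> linarith

/-! ### Samples of elements of `V(φ)` -/

/-- The sample indexed by `(i, l)` as a point of the sampling set and an order of derivative. -/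
def sampleIndex {L r : ℕ} (x : Fin L → ℝ) (p : Fin (L * r) × ℤ) :
    samplingSet (L * r) x × Fin r :=
  (⟨x p.1.divNat + ((L * r : ℕ) : ℝ) * (p.2 : ℝ), p.1.divNat, p.2, rfl⟩, p.1.modNat)

lemma sampleIndex_surjective {L r : ℕ} (x : Fin L → ℝ) :
    Function.Surjective (sampleIndex (r := r) x) := by
  rintro ⟨⟨y, n, l, rfl⟩, i⟩
  refine ⟨(finProdFinEquiv (n, i), l), ?_⟩
  have h := finProdFinEquiv.symm_apply_apply (n, i)
  rw [finProdFinEquiv_symm_apply, Prod.mk.injEq] at h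
  simp only [sampleIndex, h.1, h.2]

/-- The nodes lie in a half-open interval of length one and ρ ≥ 1, so a sample point determines its
period, and then its node. -/
lemma sampleIndex_injective {L r s : ℕ} {x : Fin L → ℝ} (hs : s < L * r)
    (hx : ∀ n, x n ∈ Set.Ico (s : ℝ) ((s : ℝ) + 1)) (hinj : Function.Injective x) :
    Function.Injective (sampleIndex (r := r) x) := by
  rintro ⟨i, l⟩ ⟨j, m⟩ h
  have h1 : x i.divNat + ((L * r : ℕ) : ℝ) * (l : ℝ) = x j.divNat + ((L * r : ℕ) : ℝ) * (m : ℝ) :=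
    congrArg (fun p => (p.1 : ℝ)) h
  have h2 : i.modNat = j.modNat := congrArg Prod.snd h
  have hρ : (1 : ℝ) ≤ ((L * r : ℕ) : ℝ) := by exact_mod_cast (by omega : 1 ≤ L * r)
  obtain ⟨ha, hb⟩ := hx i.divNat
  obtain ⟨hc, hd⟩ := hx j.divNat
  have hlm : l = m := by
    by_contra hne
    rcases lt_or_gt_of_ne hne with hlt | hlt
    · have : (l : ℝ) + 1 ≤ m := by exact_mod_cast hlt
      nlinarith
    · have : (m : ℝ) + 1 ≤ l := by exact_mod_cast hlt
      nlinarith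
  subst hlm
  have hdiv : i.divNat = j.divNat := hinj (by linarith)
  have : finProdFinEquiv.symm i = finProdFinEquiv.symm j := by
    rw [finProdFinEquiv_symm_apply, finProdFinEquiv_symm_apply, hdiv, h2]
  rw [finProdFinEquiv.symm.injective this]

/-- Coinciding nodes would produce equal rows. Distinctness is needed because the sampling set,
being a set, forgets multiplicities. -/
lemma injective_of_det_sampleMatrix_ne_zero {L r s : ℕ} {φ : ℝ → ℂ} {x : Fin L → ℝ}
    (hs : s < L * r) (h : (sampleMatrix (r := r) φ x s).det ≠ 0) : Function.Injective x := by
  intro n m hnm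
  by_contra hne
  have hr : 0 < r := Nat.pos_of_ne_zero (by rintro rfl; simp at hs)
  apply h
  refine Matrix.det_zero_of_row_eq (i := finProdFinEquiv (n, ⟨0, hr⟩))
    (j := finProdFinEquiv (m, ⟨0, hr⟩)) (by simpa using hne) ?_
  have hn := finProdFinEquiv.symm_apply_apply (n, (⟨0, hr⟩ : Fin r))
  have hm := finProdFinEquiv.symm_apply_apply (m, (⟨0, hr⟩ : Fin r))
  rw [finProdFinEquiv_symm_apply, Prod.mk.injEq] at hn hm
  ext q
  simp only [sampleMatrix, Matrix.of_apply, hn.1, hn.2, hm.1, hm.2, hnm]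

lemma iteratedDeriv_synth_sample {L r s : ℕ} {φ : ℝ → ℂ} {x : Fin L → ℝ} (hs : s < L * r)
    (hφ : ContDiff ℝ ((r - 1 : ℕ) : WithTop ℕ∞) φ)
    (hsupp : tsupport φ ⊆ Set.Icc 0 ((L * r : ℕ) : ℝ))
    (hx : ∀ n, x n ∈ Set.Ico (s : ℝ) ((s : ℝ) + 1)) (d : ℤ → ℂ) (i : Fin (L * r)) (l : ℤ) :
    iteratedDeriv (i.modNat : ℕ) (synth φ d) (x i.divNat + ((L * r : ℕ) : ℝ) * (l : ℝ)) =
      ∑ q, sampleMatrix (r := r) φ x s i q * d (blockEquiv hs (q, l)) := by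
  rw [iteratedDeriv_synth hφ hsupp i.modNat.2,
    synth_sample (support_iteratedDeriv_subset_Ioo hφ hsupp i.modNat.2) (hx _) hs]
  rfl

lemma iteratedDeriv_sampleIndex {L r s : ℕ} {φ : ℝ → ℂ} {x : Fin L → ℝ} (hs : s < L * r)
    (hφ : ContDiff ℝ ((r - 1 : ℕ) : WithTop ℕ∞) φ)
    (hsupp : tsupport φ ⊆ Set.Icc 0 ((L * r : ℕ) : ℝ))
    (hx : ∀ n, x n ∈ Set.Ico (s : ℝ) ((s : ℝ) + 1)) (d : ℤ → ℂ) (p : Fin (L * r) × ℤ) :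
    iteratedDeriv ((sampleIndex x p).2 : ℕ) (synth φ d) ((sampleIndex x p).1 : ℝ) =
      ∑ q, sampleMatrix (r := r) φ x s p.1 q * d (blockEquiv hs (q, p.2)) :=
  iteratedDeriv_synth_sample hs hφ hsupp hx d p.1 p.2

lemma sum_inv_mul_sum {ι : Type*} [Fintype ι] [DecidableEq ι] {N : Matrix ι ι ℂ}
    (hN : N.det ≠ 0) (v : ι → ℂ) (q : ι) : ∑ i, N⁻¹ q i * ∑ j, N i j * v j = v q := by
  have h : N⁻¹.mulVec (N.mulVec v) = v := by
    rw [Matrix.mulVec_mulVec, Matrix.nonsing_inv_mul _ (isUnit_iff_ne_zero.2 hN), Matrix.one_mulVec]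
  exact congrFun h q

lemma sum_mul_sum_inv {ι : Type*} [Fintype ι] [DecidableEq ι] {N : Matrix ι ι ℂ}
    (hN : N.det ≠ 0) (v : ι → ℂ) (q : ι) : ∑ i, N q i * ∑ j, N⁻¹ i j * v j = v q := by
  have h : N.mulVec (N⁻¹.mulVec v) = v := by
    rw [Matrix.mulVec_mulVec, Matrix.mul_nonsing_inv _ (isUnit_iff_ne_zero.2 hN), Matrix.one_mulVec]
  exact congrFun h q

/-! ### Determinant criterion and reconstruction -/

section

variable {L r s : ℕ} {φ : ℝ → ℂ} {x : Fin L → ℝ}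

/-- The lower sampling bound alone forces this: a kernel vector would synthesize a nonzero function
with no nonzero sample. -/
lemma det_ne_zero_of_isStableSampling (hs : s < L * r)
    (hφ : ContDiff ℝ ((r - 1 : ℕ) : WithTop ℕ∞) φ) (hst : IsStableGenerator φ)
    (hsupp : tsupport φ ⊆ Set.Icc 0 ((L * r : ℕ) : ℝ))
    (hx : ∀ n, x n ∈ Set.Ico (s : ℝ) ((s : ℝ) + 1))
    (h : IsStableSampling r φ (samplingSet (L * r) x)) :
    (sampleMatrix (r := r) φ x s).det ≠ 0 := by
  intro hdet
  obtain ⟨v, hv, hv0⟩ := Matrix.exists_mulVec_eq_zero_iff.2 hdet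
  obtain ⟨A, hA, B, hB, H⟩ := exists_synth_bounds hφ.continuous
    ((subset_tsupport φ).trans hsupp) hst
  -- The kernel vector `v` is placed in block 0, with zeros in all other blocks.
  let d : ℤ → ℂ := fun k =>
    if ((blockEquiv hs).symm k).2 = 0 then v ((blockEquiv hs).symm k).1 else 0
  have hd : ∀ q l, d (blockEquiv hs (q, l)) = if l = 0 then v q else 0 := fun q l => by
    simp only [d, Equiv.symm_apply_apply]
  have hsum : Summable fun k => ‖d k‖ ^ 2 := by
    rw [← (blockEquiv hs).summable_iff]
    refine summable_of_ne_finset_zero (s := Finset.univ ×ˢ {0}) ?_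
    rintro ⟨q, l⟩ hl
    have : l ≠ 0 := by rintro rfl; simp at hl
    simp [Function.comp_apply, -blockEquiv_apply, hd, this]
  obtain ⟨hmem, hlo, -⟩ := H d hsum
  obtain ⟨A', hA', B', hB', H'⟩ := h
  obtain ⟨-, hlo', -⟩ := H' _ hmem
  have hzero : ∀ p : samplingSet (L * r) x × Fin r,
      iteratedDeriv (p.2 : ℕ) (synth φ d) (p.1 : ℝ) = 0 := fun p => by
    obtain ⟨⟨i, l⟩, rfl⟩ := sampleIndex_surjective x p
    rw [iteratedDeriv_sampleIndex hs hφ hsupp hx]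
    simp_rw [hd]
    split_ifs with hl
    · exact congrFun hv0 i
    · simp
  simp only [hzero, norm_zero, ne_eq, OfNat.ofNat_ne_zero, not_false_eq_true, zero_pow,
    tsum_zero] at hlo'
  have hint : ∫ t, ‖synth φ d t‖ ^ 2 ≤ 0 := nonpos_of_mul_nonpos_right hlo' hA'
  have hts : ∑' k, ‖d k‖ ^ 2 ≤ 0 := nonpos_of_mul_nonpos_right (hlo.trans hint) hA
  apply hv
  ext q
  have h1 := hsum.le_tsum (blockEquiv hs (q, 0)) fun _ _ => by positivity
  rw [hd, if_pos rfl] at h1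
  have h2 : ‖v q‖ ^ 2 = 0 := le_antisymm (h1.trans hts) (by positivity)
  simpa using h2

lemma isStableSampling_of_det_ne_zero (hs : s < L * r)
    (hφ : ContDiff ℝ ((r - 1 : ℕ) : WithTop ℕ∞) φ) (hst : IsStableGenerator φ)
    (hsupp : tsupport φ ⊆ Set.Icc 0 ((L * r : ℕ) : ℝ))
    (hx : ∀ n, x n ∈ Set.Ico (s : ℝ) ((s : ℝ) + 1))
    (hdet : (sampleMatrix (r := r) φ x s).det ≠ 0) :
    IsStableSampling r φ (samplingSet (L * r) x) := by
  have hsupp' := (subset_tsupport φ).trans hsupp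
  obtain ⟨A, hA, B, hB, H⟩ := exists_synth_bounds hφ.continuous hsupp' hst
  obtain ⟨C, hC, HC⟩ := exists_blockwise_bound (sampleMatrix (r := r) φ x s)
  obtain ⟨C', hC', HC'⟩ := exists_blockwise_bound (sampleMatrix (r := r) φ x s)⁻¹
  obtain ⟨e, he⟩ : ∃ e : Fin (L * r) × ℤ ≃ samplingSet (L * r) x × Fin r,
      ∀ p, e p = sampleIndex x p := ⟨Equiv.ofBijective (sampleIndex x)
    ⟨sampleIndex_injective hs hx (injective_of_det_sampleMatrix_ne_zero hs hdet),
      sampleIndex_surjective x⟩, fun _ => rfl⟩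
  -- With S the sum of squared samples: ‖f‖² ≤ B‖d‖² ≤ BC'S, and S ≤ C‖d‖² ≤ (C/A)‖f‖².
  refine ⟨(B * C')⁻¹, by positivity, C / A, by positivity, fun f hf => ?_⟩
  obtain ⟨d, hd, rfl⟩ := eq_synth_of_mem hφ.continuous hsupp' hf
  obtain ⟨-, hlo, hhi⟩ := H d hd
  have hD : Summable fun p : Fin (L * r) × ℤ => ‖d (blockEquiv hs p)‖ ^ 2 :=
    hd.comp_injective (blockEquiv hs).injective
  have hDt : ∑' p : Fin (L * r) × ℤ, ‖d (blockEquiv hs p)‖ ^ 2 = ∑' k, ‖d k‖ ^ 2 :=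
    (blockEquiv hs).tsum_eq fun k => ‖d k‖ ^ 2
  obtain ⟨hS, hSle⟩ := HC (fun p => d (blockEquiv hs p)) hD
  obtain ⟨-, hSge⟩ := HC' (fun p => ∑ q, sampleMatrix (r := r) φ x s p.1 q *
    d (blockEquiv hs (q, p.2))) hS
  have hrec : ∀ p : Fin (L * r) × ℤ, ∑ i, (sampleMatrix (r := r) φ x s)⁻¹ p.1 i *
      ∑ q, sampleMatrix (r := r) φ x s i q * d (blockEquiv hs (q, p.2)) = d (blockEquiv hs p) :=
    fun p => sum_inv_mul_sum hdet (fun q => d (blockEquiv hs (q, p.2))) p.1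
  simp only [hrec] at hSge
  have hcomp : ∀ p, ‖iteratedDeriv ((e p).2 : ℕ) (synth φ d) ((e p).1 : ℝ)‖ ^ 2 =
      ‖∑ q, sampleMatrix (r := r) φ x s p.1 q * d (blockEquiv hs (q, p.2))‖ ^ 2 := fun p => by
    rw [he, iteratedDeriv_sampleIndex hs hφ hsupp hx d p]
  rw [← e.summable_iff, ← e.tsum_eq]
  simp only [Function.comp_def, hcomp]
  rw [hDt] at hSle
  rw [hDt] at hSge
  refine ⟨hS, ?_, ?_⟩
  · rw [inv_mul_le_iff₀ (by positivity), mul_assoc]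
    exact hhi.trans (by gcongr)
  · refine hSle.trans ?_
    rw [div_mul_eq_mul_div, le_div_iff₀ hA, mul_assoc]
    gcongr
    linarith

/-- Solve each block with the inverse matrix; the blockwise bound keeps the coefficients in ℓ². -/
lemma isInterpolation_of_det_ne_zero (hs : s < L * r)
    (hφ : ContDiff ℝ ((r - 1 : ℕ) : WithTop ℕ∞) φ) (hst : IsStableGenerator φ)
    (hsupp : tsupport φ ⊆ Set.Icc 0 ((L * r : ℕ) : ℝ))
    (hx : ∀ n, x n ∈ Set.Ico (s : ℝ) ((s : ℝ) + 1))
    (hdet : (sampleMatrix (r := r) φ x s).det ≠ 0) :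
    IsInterpolation r φ (samplingSet (L * r) x) := by
  have hsupp' := (subset_tsupport φ).trans hsupp
  obtain ⟨A, hA, B, hB, H⟩ := exists_synth_bounds hφ.continuous hsupp' hst
  obtain ⟨C', hC', HC'⟩ := exists_blockwise_bound (sampleMatrix (r := r) φ x s)⁻¹
  intro c hc
  have hc' : Summable fun p => ‖c (sampleIndex x p)‖ ^ 2 := hc.comp_injective
    (sampleIndex_injective hs hx (injective_of_det_sampleMatrix_ne_zero hs hdet))
  obtain ⟨hS, -⟩ := HC' (fun p => c (sampleIndex x p)) hc'
  let D : Fin (L * r) × ℤ → ℂ := fun p =>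
    ∑ i, (sampleMatrix (r := r) φ x s)⁻¹ p.1 i * c (sampleIndex x (i, p.2))
  have hd : Summable fun k => ‖D ((blockEquiv hs).symm k)‖ ^ 2 :=
    (blockEquiv hs).symm.summable_iff.2 hS
  refine ⟨_, (H _ hd).1, fun p => ?_⟩
  obtain ⟨⟨i, l⟩, rfl⟩ := sampleIndex_surjective x p
  rw [iteratedDeriv_sampleIndex hs hφ hsupp hx]
  simp only [Equiv.symm_apply_apply, D]
  exact sum_mul_sum_inv hdet (fun i => c (sampleIndex x (i, l))) i

/-- The identity is purely algebraic: all sums at a fixed `t` are finite, so `d` may be arbitrary.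
-/
lemma reconstruction (hs : s < L * r)
    (hφ : ContDiff ℝ ((r - 1 : ℕ) : WithTop ℕ∞) φ)
    (hsupp : tsupport φ ⊆ Set.Icc 0 ((L * r : ℕ) : ℝ))
    (hx : ∀ n, x n ∈ Set.Ico (s : ℝ) ((s : ℝ) + 1))
    (hdet : (sampleMatrix (r := r) φ x s).det ≠ 0) (d : ℤ → ℂ) (t : ℝ) :
    (∀ n : Fin L, Summable fun l : ℤ => ∑ i : Fin r,
      iteratedDeriv (i : ℕ) (synth φ d) (x n + ((L * r : ℕ) : ℝ) * (l : ℝ)) *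
        kernel φ x n i (t - ((L * r : ℕ) : ℝ) * (l : ℝ))) ∧
    synth φ d t = ∑ n : Fin L, ∑' l : ℤ, ∑ i : Fin r,
      iteratedDeriv (i : ℕ) (synth φ d) (x n + ((L * r : ℕ) : ℝ) * (l : ℝ)) *
        kernel φ x n i (t - ((L * r : ℕ) : ℝ) * (l : ℝ)) := by
  have hsupp' := (subset_tsupport φ).trans hsupp
  have hker := kernel_eq hs (fun p hp => support_iteratedDeriv_subset_Ioo hφ hsupp hp) hx
  have hsum : ∀ n : Fin L, Summable fun l : ℤ => ∑ i : Fin r,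
      iteratedDeriv (i : ℕ) (synth φ d) (x n + ((L * r : ℕ) : ℝ) * (l : ℝ)) *
        kernel φ x n i (t - ((L * r : ℕ) : ℝ) * (l : ℝ)) := by
    intro n
    refine summable_sum fun i _ => ?_
    simp_rw [hker, Finset.mul_sum]
    refine summable_sum fun q _ => ?_
    -- Chosen so that, for fixed `q`, the series over `l` is a subfamily of a locally finite sum of
    -- translates.
    let c : ℤ → ℂ := fun k =>
      iteratedDeriv (i : ℕ) (synth φ d)
          (x n + ((L * r : ℕ) : ℝ) * (((blockEquiv hs).symm k).2 : ℝ)) *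
        (sampleMatrix (r := r) φ x s)⁻¹ q (finProdFinEquiv (n, i))
    have h := (hasSum_synth hsupp' c t).summable.comp_injective
      ((blockEquiv hs).injective.comp (Prod.mk_right_injective q))
    refine h.congr fun l => ?_
    simp only [Function.comp_apply, c, Equiv.symm_apply_apply, mul_assoc]
    congr 3
    rw [blockEquiv_apply]
    push_cast
    ring
  refine ⟨hsum, ?_⟩
  -- With the sum over `l` outermost, the two sides agree block by block.
  rw [← Summable.tsum_finsetSum fun n _ => hsum n,
    ← (synth_eq_tsum_blocks hsupp' hs d t).tsum_eq]
  refine tsum_congr fun l => ?_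
  rw [← Fintype.sum_prod_type' fun (n : Fin L) (i : Fin r) =>
      iteratedDeriv (i : ℕ) (synth φ d) (x n + ((L * r : ℕ) : ℝ) * (l : ℝ)) *
        kernel φ x n i (t - ((L * r : ℕ) : ℝ) * (l : ℝ)),
    ← finProdFinEquiv.symm.sum_comp]
  simp_rw [hker, Prod.mk.eta, Equiv.apply_symm_apply, finProdFinEquiv_symm_apply,
    iteratedDeriv_synth_sample hs hφ hsupp hx, Finset.mul_sum]
  rw [Finset.sum_comm]
  refine Finset.sum_congr rfl fun q _ => ?_
  rw [← sum_inv_mul_sum hdet (fun q => d (blockEquiv hs (q, l))) q, Finset.sum_mul]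
  refine Finset.sum_congr rfl fun i _ => ?_
  ring

end

end

end PNS

theorem theorem3p2 (L r s : ℕ) (μ : ℝ) (φ : ℝ → ℂ) (x : Fin L → ℝ)
    (hA : PNS.ClassA r φ) (hstable : PNS.IsStableGenerator φ)
    (hsupp : tsupport φ ⊆ Set.Icc 0 μ)
    (hs : s < L * r) (hx : ∀ n, x n ∈ Set.Ico (s : ℝ) ((s : ℝ) + 1))
    (hμ : μ ≤ ((L * r : ℕ) : ℝ)) :
    (PNS.IsCompleteInterpolation r φ (PNS.samplingSet (L * r) x) ↔
      (PNS.collocation (r := r) φ x s).det ≠ 0) ∧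
    ((PNS.collocation (r := r) φ x s).det ≠ 0 →
      (∀ (n : Fin L) (i : Fin r),
        (∀ t : ℝ, PNS.kernel φ x n i t =
          (∑ q ∈ Finset.univ.filter (fun q : Fin (L * r) => (q : ℕ) ≤ s),
            PNS.invCoeff φ x 0 q n i * φ (t - ((q : ℕ) : ℝ))) +
          ∑ q ∈ Finset.univ.filter (fun q : Fin (L * r) => s < (q : ℕ)),
            PNS.invCoeff φ x (-1) q n i * φ (t + ((L * r : ℕ) : ℝ) - ((q : ℕ) : ℝ))) ∧
        PNS.ClassA r (PNS.kernel φ x n i) ∧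
        tsupport (PNS.kernel φ x n i) ⊆
          Set.Icc (-((L * r : ℕ) : ℝ) + (s : ℝ) + 1) (μ + (s : ℝ))) ∧
      ∀ f ∈ PNS.shiftSpace φ,
        ContDiff ℝ ((r - 1 : ℕ) : WithTop ℕ∞) f ∧
        ∀ t : ℝ,
          (∀ n : Fin L, Summable fun l : ℤ => ∑ i : Fin r,
            iteratedDeriv (i : ℕ) f (x n + ((L * r : ℕ) : ℝ) * (l : ℝ)) *
              PNS.kernel φ x n i (t - ((L * r : ℕ) : ℝ) * (l : ℝ))) ∧
          f t = ∑ n : Fin L, ∑' l : ℤ, ∑ i : Fin r,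
            iteratedDeriv (i : ℕ) f (x n + ((L * r : ℕ) : ℝ) * (l : ℝ)) *
              PNS.kernel φ x n i (t - ((L * r : ℕ) : ℝ) * (l : ℝ))) := by
  have hφ := hA.1
  have hsupp' : tsupport φ ⊆ Set.Icc 0 ((L * r : ℕ) : ℝ) :=
    hsupp.trans (Set.Icc_subset_Icc_right hμ)
  have hIoo : ∀ p < r, Function.support (iteratedDeriv p φ) ⊆ Set.Ioo 0 ((L * r : ℕ) : ℝ) :=
    fun p hp => PNS.support_iteratedDeriv_subset_Ioo hφ hsupp' hp
  rw [← PNS.det_sampleMatrix_ne_zero_iff φ x hs]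
  refine ⟨⟨fun h => PNS.det_ne_zero_of_isStableSampling hs hφ hstable hsupp' hx h.1, fun h =>
    ⟨PNS.isStableSampling_of_det_ne_zero hs hφ hstable hsupp' hx h,
      PNS.isInterpolation_of_det_ne_zero hs hφ hstable hsupp' hx h⟩⟩, fun hdet => ⟨?_, ?_⟩⟩
  · intro n i
    refine ⟨PNS.kernel_eq_split hs hIoo hx n i, ?_⟩
    rw [funext (PNS.kernel_eq hs hIoo hx n i)]
    have hK : HasCompactSupport φ := isCompact_Icc.of_isClosed_subset (isClosed_tsupport φ) hsupp
    refine ⟨hA.sum_translates hK _ _, PNS.tsupport_sum_translates_subset hsupp _ _ fun q => ?_⟩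
    obtain ⟨h1, h2⟩ := PNS.windowRep_bounds hs q.2
    constructor
    · have : (s : ℝ) + 1 - ((L * r : ℕ) : ℝ) ≤ PNS.windowRep (L * r) s q := by exact_mod_cast h1
      linarith
    · exact_mod_cast h2
  · intro f hf
    obtain ⟨d, -, rfl⟩ := PNS.eq_synth_of_mem hφ.continuous ((subset_tsupport φ).trans hsupp') hf
    exact ⟨PNS.contDiff_synth hφ ((subset_tsupport φ).trans hsupp') d,
      PNS.reconstruction hs hφ hsupp' hx hdet d⟩
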